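/- A GF(2)-grammar over an alphabet $\Sigma$ is a context-free grammar $G=(\Sigma,N,R,S)$ (with $R$ a finite set of rules $A\to X_1\cdots X_\ell$, $\ell\ge 0$, $X_i\in\Sigma\cup N$) such that for every $A\in N$ and every word $w\in\Sigma^*$ the number of parse trees of $w$ with root $A$ is finite. The language $L_G(A)$ is the set of all words that have an odd number of parse trees with root $A$, and the language described by $G$ is $L_G(S)$. Let $a,b,c\in\Sigma$ be pairwise distinct letters. For $K\subseteq a^*b^*c^*$ put $$\mathrm{Dual}(K)=\sum_{(i,j,k)\in\mathbb N_0^3,\ a^ib^jc^k\in K} a^ib^jc^k\in\mathbb F_2[[a,b,c]].$$ Let $\mathcal A$, $\mathcal B$, $\mathcal C$ be the sets of formal power series in $\mathbb F_2[[a]]$, $\mathbb F_2[[b]]$, $\mathbb F_2[[c]]$ that are algebraic, i.e. are roots of a nonzero polynomial with coefficients in $\mathbb F_2[a]$, $\mathbb F_2[b]$, $\mathbb F_2[c]$ respectively. Let $R_{a,b,c}$ be the set of all elements of the fraction field $\mathbb F_2((a,b,c))$ of $\mathbb F_2[[a,b,c]]$ that can be written as $$\frac{\sum_{i=1}^n A_iB_iC_i}{p_{a,b}\,p_{a,c}\,p_{b,c}},$$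 where $n\ge 0$, $A_i\in\mathcal A$, $B_i\in\mathcal B$, $C_i\in\mathcal C$ for all $i$, and $p_{a,b}\in\mathbb F_2[a,b]$, $p_{a,c}\in\mathbb F_2[a,c]$, $p_{b,c}\in\mathbb F_2[b,c]$ are nonzero polynomials. **Theorem.** If $K\subseteq a^*b^*c^*$ is described by a GF(2)-grammar over $\Sigma$, then $\mathrm{Dual}(K)\in R_{a,b,c}$. -/

import Mathlib

noncomputable section

/-- `ParseForest g β w` is the type of ordered forests of (complete) parse trees of the ordinary
context-free grammar `g` whose sequence of root labels is `β` and whose yield is the word `w`.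
A terminal symbol is a leaf; an inner node labelled by a nonterminal carries a rule of `g` for that
nonterminal, and its children form a forest whose roots spell the right-hand side of the rule. -/
inductive ParseForest {T : Type*} (g : ContextFreeGrammar T) :
    List (Symbol T g.NT) → List T → Type _
  | nil : ParseForest g [] []
  | leaf (t : T) {β : List (Symbol T g.NT)} {v : List T} (rest : ParseForest g β v) :
      ParseForest g (Symbol.terminal t :: β) (t :: v)
  | node (r : ContextFreeRule T g.NT) (hr : r ∈ g.rules)
      {β : List (Symbol T g.NT)} {u v : List T}
      (children : ParseForest g r.output u) (rest : ParseForest g β v) :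
      ParseForest g (Symbol.nonterminal r.input :: β) (u ++ v)

/-- The parse trees of the word `w` as the nonterminal `A`: forests that consist of a single tree,
with root `A` and yield `w`. -/
abbrev ParseTree {T : Type*} (g : ContextFreeGrammar T) (A : g.NT) (w : List T) :=
  ParseForest g [Symbol.nonterminal A] w

/-- A GF(2)-grammar over the alphabet `T`: syntactically an ordinary context-free grammar, in which
every word has only finitely many parse trees. -/
structure GF2Grammar (T : Type*) extends ContextFreeGrammar T where
  finite_parseTree : ∀ (A : NT) (w : List T), Finite (ParseTree toContextFreeGrammar A w)

/-- The language `L_G(A)`: all words that have an odd number of parse trees as `A`. -/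
def GF2Grammar.languageOf {T : Type*} (G : GF2Grammar T) (A : G.NT) : Language T :=
  {w | Odd (Nat.card (ParseTree G.toContextFreeGrammar A w))}

/-- The language described by a GF(2)-grammar, that is, the language of its initial symbol. -/
def GF2Grammar.language {T : Type*} (G : GF2Grammar T) : Language T :=
  G.languageOf G.initial

/-- The word `a^i b^j c^k`. -/
def abcWord {T : Type*} (a b c : T) (i j k : ℕ) : List T :=
  List.replicate i a ++ List.replicate j b ++ List.replicate k c

/-- The language `a^* b^* c^*`. -/
def abcLanguage {T : Type*} (a b c : T) : Language T :=
  {w | ∃ i j k : ℕ, w = abcWord a b c i j k}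

/-- The ring `𝔽₂[[a, b, c]]`; the variables `a`, `b`, `c` have the indices `0`, `1`, `2`. -/
abbrev SeriesABC : Type := MvPowerSeries (Fin 3) (ZMod 2)

/-- The field `𝔽₂((a, b, c))` of fractions of formal power series. -/
abbrev LaurentABC : Type := FractionRing SeriesABC

open Classical in
/-- The formal power series of a language `K ⊆ a^* b^* c^*`: the coefficient of
`a^i b^j c^k` is `1` if the word `a^i b^j c^k` is in `K`, and `0` otherwise. -/
def dualSeries {T : Type*} (a b c : T) (K : Language T) : SeriesABC :=
  fun m => if abcWord a b c (m 0) (m 1) (m 2) ∈ K then 1 else 0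

/-- A one-variable power series `f(t)` as a series in the `i`-th of the variables `a, b, c`. -/
def inVariable (i : Fin 3) (f : PowerSeries (ZMod 2)) : SeriesABC :=
  MvPowerSeries.rename (fun _ : Unit => i) f

/-- The algebraic power series in the `i`-th of the variables `a, b, c`: the sets `𝒜`, `ℬ`, `𝒞`
for `i = 0, 1, 2`. A one-variable series is algebraic if it is a root of a nonzero polynomial with
coefficients in `𝔽₂[t]`. -/
def algebraicSeries (i : Fin 3) : Set SeriesABC :=
  {F | ∃ f : PowerSeries (ZMod 2), IsAlgebraic (Polynomial (ZMod 2)) f ∧ F = inVariable i f}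

/-- The nonzero polynomials in only the `i`-th and the `j`-th of the variables `a, b, c`,
as power series. -/
def nonzeroPoly (i j : Fin 3) : Set SeriesABC :=
  {P | ∃ p ∈ MvPolynomial.supported (ZMod 2) ({i, j} : Set (Fin 3)),
    p ≠ 0 ∧ P = (p : MvPowerSeries (Fin 3) (ZMod 2))}

/-- The set `R_{a,b,c}` of all Laurent series `(∑ A_i B_i C_i) / (p_{a,b} p_{a,c} p_{b,c})`. -/
def RABC : Set LaurentABC :=
  {x | ∃ (n : ℕ) (A B C : Fin n → SeriesABC) (pab pac pbc : SeriesABC),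
    (∀ i, A i ∈ algebraicSeries 0) ∧ (∀ i, B i ∈ algebraicSeries 1) ∧
    (∀ i, C i ∈ algebraicSeries 2) ∧
    pab ∈ nonzeroPoly 0 1 ∧ pac ∈ nonzeroPoly 0 2 ∧ pbc ∈ nonzeroPoly 1 2 ∧
    x = algebraMap SeriesABC LaurentABC (∑ i, A i * B i * C i) /
      algebraMap SeriesABC LaurentABC (pab * pac * pbc)}

end

/-! For a string `β` of symbols, count modulo 2 the parse forests with roots `β`. The count of `X ::
β` is the convolution of the counts of `[X]` and `β`. Restrict the counts to powers of one letter
(line series), to the words a^i b^j or b^j c^k (plane series), and to the words a^i b^j c^k (space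
series). A factorization of such a word cuts it inside one of its blocks, and a cut at a block
boundary belongs to two blocks. So line series are multiplicative. A plane or space series D
satisfies D(Xβ) = P(X)D(β) + Q(β)D(X) + lower terms, where P and Q are the line series of the first
and the last letter, and the lower terms involve only series of smaller dimension. Thus D is a
twisted derivation up to lower terms, and the rules of the grammar become a linear system (1 - J)D =
lower terms over the finitely many productive nonterminals, J being a noncommutative Jacobian.

The determinant of 1 - J is nonzero because its constant coefficient is. That coefficient involves
only forests with empty yield, and there J follows the relation `EmptyContext`, which is
well-founded: a cycle would allow one word to have arbitrarily large parse trees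
(`det_one_sub_systemMatrix_ne_zero`).

The same determinant shows that line series are algebraic. Let D be the universal derivation of the
field they generate over 𝔽₂(t). Now P = Q, the system is homogeneous, so D vanishes on the
generators and the field is separable algebraic (`isAlgebraic_of_system`).

Solving the system for a plane series places it in the field generated by algebraic series in two
variables. By algebraicity this field is a ring generated over the rational functions, so its
elements are sums of products over a polynomial in these two variables (`algebraicSubfield_le`). For
the space series, the plane series on the right-hand side contribute p_{a,b} and p_{b,c}, and the
inverse of 1 - J, which is over the field for a and c, contributes p_{a,c}
(`spaceSeries_count_mem`). -/

noncomputable section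

/-! ### Parse forests: grafting, decomposition, finiteness -/

namespace ParseForest

variable {T : Type*} {g : ContextFreeGrammar T}

/-- The number of inner nodes of a forest. -/
def size : {β : List (Symbol T g.NT)} → {w : List T} → ParseForest g β w → ℕ
  | _, _, nil => 0
  | _, _, leaf _ rest => rest.size
  | _, _, node _ _ children rest => children.size + rest.size + 1

/-- Yields of grafted forests agree only up to list identities. Keeping just the size in an
existential avoids working with casts. -/
theorem exists_size_eq {β : List (Symbol T g.NT)} {u v : List T} (s : ParseForest g β u)
    (h : u = v) : ∃ t : ParseForest g β v, t.size = s.size := by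
  subst h
  exact ⟨s, rfl⟩

theorem exists_append {α : List (Symbol T g.NT)} {u : List T} (s : ParseForest g α u)
    {β : List (Symbol T g.NT)} {v : List T} (t : ParseForest g β v) :
    ∃ f : ParseForest g (α ++ β) (u ++ v), f.size = s.size + t.size := by
  induction s with
  | nil => exact ⟨t, by simp [size]⟩
  | leaf a rest ih =>
    obtain ⟨f, hf⟩ := ih
    exact ⟨leaf a f, by simp [size, hf]⟩
  | node r hr children rest _ ih =>
    obtain ⟨f, hf⟩ := ih
    rw [List.append_assoc]
    exact ⟨node r hr children f, by simp [size, hf]; omega⟩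

/-- Splitting off the first symbol of a forest when it is a nonterminal. -/
def consNonterminalEquiv (A : g.NT) (β : List (Symbol T g.NT)) (w : List T) :
    ParseForest g (Symbol.nonterminal A :: β) w ≃
      Σ (r : {r // r ∈ g.rules ∧ r.input = A}) (p : {p : List T × List T // p.1 ++ p.2 = w}),
        ParseForest g r.1.output p.1.1 × ParseForest g β p.1.2 where
  toFun
    | node (u := u) (v := v) r hr children rest =>
      ⟨⟨r, hr, rfl⟩, ⟨(u, v), rfl⟩, children, rest⟩
  invFun := by
    rintro ⟨⟨r, hr, rfl⟩, ⟨⟨u, v⟩, rfl⟩, children, rest⟩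
    exact node r hr children rest
  left_inv := by rintro ⟨⟩; rfl
  right_inv := by rintro ⟨⟨r, hr, rfl⟩, ⟨⟨_, _⟩, rfl⟩, children, rest⟩; rfl

/-- Splitting off the first symbol of a forest when it is a terminal. -/
def consTerminalEquiv (a : T) (β : List (Symbol T g.NT)) (w : List T) :
    ParseForest g (Symbol.terminal a :: β) (a :: w) ≃ ParseForest g β w where
  toFun | leaf _ rest => rest
  invFun rest := leaf a rest
  left_inv := by rintro ⟨⟩; rfl
  right_inv _ := rfl

theorem finite (h : ∀ A w, Finite (ParseTree g A w)) (β : List (Symbol T g.NT)) (w : List T) :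
    Finite (ParseForest g β w) := by
  induction β generalizing w with
  | nil =>
    have : Subsingleton (ParseForest g [] w) := ⟨by rintro ⟨⟩ ⟨⟩; rfl⟩
    infer_instance
  | cons X β ih =>
    cases X with
    | terminal a =>
      rcases w with _ | ⟨b, w⟩
      · have : IsEmpty (ParseForest g (Symbol.terminal a :: β) []) := ⟨by rintro ⟨⟩⟩
        infer_instance
      · by_cases hab : a = b
        · subst hab
          have := ih w
          exact Finite.of_equiv _ (consTerminalEquiv a β w).symm
        · have : IsEmpty (ParseForest g (Symbol.terminal a :: β) (b :: w)) :=
            ⟨by rintro ⟨⟩; exact hab rfl⟩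
          infer_instance
    | nonterminal A =>
      have h1 : Finite {r // r ∈ g.rules ∧ r.input = A} :=
        Finite.of_injective (fun r => (⟨r.1, r.2.1⟩ : g.rules)) fun r s hrs => by
          simpa [Subtype.ext_iff] using hrs
      have h2 : Finite {p : List T × List T // p.1 ++ p.2 = w} :=
        Finite.of_injective (fun p => (⟨p.1.1.length, by
          have := congrArg List.length p.2; simp at this; omega⟩ : Fin (w.length + 1))) <| by
          rintro ⟨⟨u, v⟩, rfl⟩ ⟨⟨u', v'⟩, h⟩ hh
          simp only [Fin.mk.injEq] at hh
          have := List.append_inj h hh.symm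
          simp_all
      -- Putting a root node on a forest of children embeds these forests into parse trees, so the
      -- right-hand sides of rules need no induction.
      have h3 : ∀ r : {r // r ∈ g.rules ∧ r.input = A}, ∀ u, Finite (ParseForest g r.1.output u) := by
        rintro ⟨r, hr, rfl⟩ u
        have := h r.input (u ++ [])
        exact Finite.of_injective (fun t => (node r hr t nil : ParseTree g r.input (u ++ [])))
          fun t s hts => by simpa using hts
      exact Finite.of_equiv _ (consNonterminalEquiv A β w).symm

end ParseForest

/-! ### Convolution over factorizations of words -/

/-- Convolution of two functions on words: the sum over all factorizations of the argument. -/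
def conv {T R : Type*} [Semiring R] (f g : List T → R) : List T → R
  | [] => f [] * g []
  | t :: w => f [] * g (t :: w) + conv (fun u => f (t :: u)) g w

section conv

variable {T R : Type*} [Semiring R]

/-- A cut of `u ++ v` lies in `u` or in `v`. The cut between them is counted in both sums on the
right, hence the extra term on the left. -/
theorem conv_append (f g : List T → R) (u v : List T) :
    conv f g (u ++ v) + f u * g v =
      conv f (fun x => g (x ++ v)) u + conv (fun x => f (u ++ x)) g v := by
  induction u generalizing f with
  | nil => simp [conv, add_comm]
  | cons t u ih => simp [conv, add_assoc, ih]

theorem conv_replicate (f g : List T → R) (a : T) (n : ℕ) :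
    conv f g (List.replicate n a) = ∑ p ∈ Finset.HasAntidiagonal.antidiagonal n,
      f (List.replicate p.1 a) * g (List.replicate p.2 a) := by
  induction n generalizing f with
  | zero => simp [conv]
  | succ n ih => simp [List.replicate_succ, conv, ih, Finset.Nat.antidiagonal_succ]

theorem conv_eq_sum_range (f g : List T → R) (w : List T) :
    conv f g w = ∑ n ∈ Finset.range (w.length + 1), f (w.take n) * g (w.drop n) := by
  induction w generalizing f with
  | nil => simp [conv]
  | cons t w ih =>
    rw [List.length_cons, Finset.sum_range_succ', conv, ih, add_comm]
    simp

theorem conv_map {S : Type*} [Semiring S] (φ : R →+* S) (f g : List T → R) (w : List T) :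
    conv (fun u => φ (f u)) (fun u => φ (g u)) w = φ (conv f g w) := by
  simp [conv_eq_sum_range]

theorem conv_sum {ι : Type*} (s : Finset ι) (f : ι → List T → R) (g : List T → R) (w : List T) :
    conv (fun u => ∑ i ∈ s, f i u) g w = ∑ i ∈ s, conv (f i) g w := by
  simp only [conv_eq_sum_range, Finset.sum_mul]
  exact Finset.sum_comm

theorem conv_ite_nil (f : List T → R) (w : List T) [DecidableEq T] :
    conv f (fun u => if u = [] then 1 else 0) w = f w := by
  induction w generalizing f with
  | nil => simp [conv]
  | cons t w ih => simp [conv, ih]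

end conv

/-- The factorizations of a word correspond to the positions in it. -/
def splitEquiv {T : Type*} (w : List T) :
    Fin (w.length + 1) ≃ {p : List T × List T // p.1 ++ p.2 = w} where
  toFun n := ⟨(w.take n, w.drop n), by simp⟩
  invFun p := ⟨p.1.1.length, by have := congrArg List.length p.2; simp at this; omega⟩
  left_inv n := by ext; simp; omega
  right_inv := by rintro ⟨⟨u, v⟩, rfl⟩; simp

theorem natCard_sigma_split {T : Type*} (F G : List T → Type*) [∀ w, Finite (F w)]
    [∀ w, Finite (G w)] (w : List T) :
    Nat.card (Σ p : {p : List T × List T // p.1 ++ p.2 = w}, F p.1.1 × G p.1.2) =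
      conv (fun u => Nat.card (F u)) (fun u => Nat.card (G u)) w := by
  rw [← Nat.card_congr (Equiv.sigmaCongrLeft (splitEquiv w)
      (β := fun p => F p.1.1 × G p.1.2)), Nat.card_sigma, conv_eq_sum_range, Finset.sum_range]
  simp [Nat.card_prod, splitEquiv]

/-! ### Counts modulo two and the order by empty contexts -/

namespace GF2Grammar

variable {T : Type*} (G : GF2Grammar T)

instance finite_parseForest (β : List (Symbol T G.NT)) (w : List T) :
    Finite (ParseForest G.toContextFreeGrammar β w) :=
  ParseForest.finite G.finite_parseTree β w

/-- The number of parse forests, modulo two. -/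
def count (β : List (Symbol T G.NT)) (w : List T) : ZMod 2 :=
  (Nat.card (ParseForest G.toContextFreeGrammar β w) : ℕ)

theorem count_nil [DecidableEq T] (w : List T) : G.count [] w = if w = [] then 1 else 0 := by
  split_ifs with h
  · subst h
    have : Unique (ParseForest G.toContextFreeGrammar [] []) := ⟨⟨.nil⟩, by rintro ⟨⟩; rfl⟩
    simp [count]
  · have : IsEmpty (ParseForest G.toContextFreeGrammar [] w) := ⟨by rintro ⟨⟩; exact h rfl⟩
    simp [count]

theorem count_terminal [DecidableEq T] (a : T) (w : List T) :
    G.count [.terminal a] w = if w = [a] then 1 else 0 := by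
  split_ifs with h
  · subst h
    rw [count, Nat.card_congr (ParseForest.consTerminalEquiv a [] []), ← count, count_nil]
    simp
  · have : IsEmpty (ParseForest G.toContextFreeGrammar [.terminal a] w) :=
      ⟨by rintro (_ | ⟨_, ⟨⟩⟩); exact h rfl⟩
    simp [count]

theorem count_cons_terminal (a : T) (β : List (Symbol T G.NT)) (w : List T) :
    G.count (.terminal a :: β) w = conv (G.count [.terminal a]) (G.count β) w := by
  classical
  have e : G.count [.terminal a] = fun w => if w = [a] then 1 else 0 :=
    funext (G.count_terminal a)
  rcases w with _ | ⟨b, w⟩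
  · have : IsEmpty (ParseForest G.toContextFreeGrammar (.terminal a :: β) []) := ⟨by rintro ⟨⟩⟩
    rw [e]
    simp [count, conv]
  · by_cases hab : b = a
    · subst hab
      rw [count, Nat.card_congr (ParseForest.consTerminalEquiv b β w), ← count, e]
      rcases w with _ | ⟨c, w⟩ <;> simp [conv, conv_eq_sum_range]
    · have : IsEmpty (ParseForest G.toContextFreeGrammar (.terminal a :: β) (b :: w)) :=
        ⟨by rintro ⟨⟩; exact hab rfl⟩
      rw [e]
      simp [conv, conv_eq_sum_range, hab, count]

open Classical in
/-- The rules for a nonterminal. -/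
def rulesOf (A : G.NT) : Finset (ContextFreeRule T G.NT) := G.rules.filter fun r => r.input = A

theorem count_cons_nonterminal_rules (A : G.NT) (β : List (Symbol T G.NT)) (w : List T) :
    G.count (.nonterminal A :: β) w =
      ∑ r ∈ G.rulesOf A, conv (G.count r.output) (G.count β) w := by
  classical
  have e : {r // r ∈ G.rules ∧ r.input = A} ≃ G.rulesOf A :=
    Equiv.subtypeEquivRight fun r => by simp [rulesOf]
  have : Fintype {r // r ∈ G.rules ∧ r.input = A} := Fintype.ofEquiv _ e.symm
  have : Finite {p : List T × List T // p.1 ++ p.2 = w} := Finite.of_equiv _ (splitEquiv w)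
  rw [count, Nat.card_congr (ParseForest.consNonterminalEquiv A β w), Nat.card_sigma]
  have h (r : ContextFreeRule T G.NT) := natCard_sigma_split
    (ParseForest G.toContextFreeGrammar r.output) (ParseForest G.toContextFreeGrammar β) w
  simp only [h, Nat.cast_sum]
  rw [Finset.sum_subtype (p := fun r => r ∈ G.rules ∧ r.input = A) (G.rulesOf A)
    (by simp [rulesOf])]
  refine Finset.sum_congr rfl fun r _ => ?_
  exact (conv_map (Nat.castRingHom (ZMod 2)) _ _ w).symm

theorem count_nonterminal (A : G.NT) (w : List T) :
    G.count [.nonterminal A] w = ∑ r ∈ G.rulesOf A, G.count r.output w := by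
  classical
  rw [count_cons_nonterminal_rules]
  refine Finset.sum_congr rfl fun r _ => ?_
  rw [funext G.count_nil, conv_ite_nil]

theorem count_cons (X : Symbol T G.NT) (β : List (Symbol T G.NT)) :
    G.count (X :: β) = conv (G.count [X]) (G.count β) := by
  ext w
  cases X with
  | terminal a => exact G.count_cons_terminal a β w
  | nonterminal A =>
    rw [count_cons_nonterminal_rules, funext (G.count_nonterminal A), conv_sum]

/-- A nonterminal is productive if it has a parse tree. -/
abbrev Productive : Type :=
  {A : G.NT // ∃ w, Nonempty (ParseTree G.toContextFreeGrammar A w)}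

/-- The root of a parse tree uses a rule, and there are finitely many rules. The type of
nonterminals itself may be infinite. -/
instance : Finite G.Productive := by
  have h : ∀ A : G.Productive, ∃ r : G.rules, r.1.input = A.1 := by
    rintro ⟨A, w, ⟨_ | _ | ⟨r, hr, _, _⟩⟩⟩
    exact ⟨⟨r, hr⟩, rfl⟩
  choose f hf using h
  exact Finite.of_injective f fun A B hAB => Subtype.ext (by rw [← hf, ← hf, hAB])

instance : Fintype G.Productive := Fintype.ofFinite _

theorem count_eq_zero_of_not_productive (A : G.NT)
    (hA : ¬∃ w, Nonempty (ParseTree G.toContextFreeGrammar A w)) :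
    G.count [.nonterminal A] = 0 := by
  ext w
  have : IsEmpty (ParseTree G.toContextFreeGrammar A w) :=
    not_nonempty_iff.mp fun h => hA ⟨w, h⟩
  simp [count]

theorem nonempty_of_count_ne_zero {β : List (Symbol T G.NT)} {w : List T} (h : G.count β w ≠ 0) :
    Nonempty (ParseForest G.toContextFreeGrammar β w) := by
  by_contra hn
  rw [not_nonempty_iff] at hn
  simp [count] at h

/-- `B` is an immediate descendant of `A` in a context with empty yield. -/
def EmptyContext (B A : G.Productive) : Prop :=
  ∃ r ∈ G.rulesOf A, ∃ α γ : List (Symbol T G.NT), r.output = α ++ .nonterminal B.1 :: γ ∧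
    Nonempty (ParseForest G.toContextFreeGrammar α []) ∧
    Nonempty (ParseForest G.toContextFreeGrammar γ [])

/-- Surrounding the tree by forests with empty yield and adding a root node for `A` keeps the yield
and increases the size. -/
theorem EmptyContext.exists_size_lt {B A : G.Productive} (h : G.EmptyContext B A) {w : List T}
    (t : ParseTree G.toContextFreeGrammar B.1 w) :
    ∃ s : ParseTree G.toContextFreeGrammar A.1 w, t.size < s.size := by
  obtain ⟨r, hr, α, γ, hout, ⟨x⟩, ⟨y⟩⟩ := h
  simp only [rulesOf, Finset.mem_filter] at hr
  obtain ⟨f, hf⟩ := ParseForest.exists_append t y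
  obtain ⟨f', hf'⟩ := ParseForest.exists_append x f
  have key : ∃ f' : ParseForest G.toContextFreeGrammar r.output w, t.size ≤ f'.size := by
    rw [hout]
    obtain ⟨f'', hf''⟩ := f'.exists_size_eq (by simp : _ = w)
    exact ⟨f'', by omega⟩
  obtain ⟨f', hf'⟩ := key
  obtain ⟨A, hA⟩ := A
  obtain ⟨hr, rfl⟩ := hr
  obtain ⟨s, hs⟩ := (ParseForest.node r hr f' .nil).exists_size_eq (List.append_nil w)
  exact ⟨s, by rw [hs]; simp only [ParseForest.size]; omega⟩

theorem wellFounded_emptyContext : WellFounded G.EmptyContext := by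
  have key : ∀ A B : G.Productive, Relation.TransGen G.EmptyContext B A → ∀ w,
      ∀ t : ParseTree G.toContextFreeGrammar B.1 w,
      ∃ s : ParseTree G.toContextFreeGrammar A.1 w, t.size < s.size := by
    intro A B h w t
    induction h with
    | single h => exact h.exists_size_lt G t
    | tail _ h ih =>
      obtain ⟨s, hs⟩ := ih
      obtain ⟨s', hs'⟩ := h.exists_size_lt G s
      exact ⟨s', hs.trans hs'⟩
  -- Productivity provides a word with a tree. Its trees are finite in number, so one is largest,
  -- and a cycle through `A` would enlarge it.
  have : Std.Irrefl (Relation.TransGen G.EmptyContext) := ⟨fun A h => by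
    obtain ⟨w, ⟨t⟩⟩ := A.2
    have : Nonempty (ParseTree G.toContextFreeGrammar A.1 w) := ⟨t⟩
    obtain ⟨m, hm⟩ := Finite.exists_max
      (fun t : ParseTree G.toContextFreeGrammar A.1 w => t.size)
    obtain ⟨s, hs⟩ := key A A h w m
    exact absurd (hm s) (by omega)⟩
  exact (Finite.wellFounded_of_trans_of_irrefl (Relation.TransGen G.EmptyContext)).mono
    fun _ _ h => .single h

end GF2Grammar

/-! ### Line, plane and space series and their Leibniz rules -/

/-- The series in `𝔽₂[[a, b, c]]` with the given coefficients. -/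
def ofCoeff (h : ℕ → ℕ → ℕ → ZMod 2) : SeriesABC := fun m => h (m 0) (m 1) (m 2)

theorem coeff_ofCoeff (h : ℕ → ℕ → ℕ → ZMod 2) (m : Fin 3 →₀ ℕ) :
    MvPowerSeries.coeff m (ofCoeff h) = h (m 0) (m 1) (m 2) := rfl

theorem ofCoeff_add (F H : ℕ → ℕ → ℕ → ZMod 2) :
    ofCoeff F + ofCoeff H = ofCoeff fun i j k => F i j k + H i j k := rfl

open Finset.HasAntidiagonal in
theorem ofCoeff_mul (F H : ℕ → ℕ → ℕ → ZMod 2) :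
    ofCoeff F * ofCoeff H = ofCoeff fun i j k => ∑ p ∈ antidiagonal i, ∑ q ∈ antidiagonal j,
      ∑ r ∈ antidiagonal k, F p.1 q.1 r.1 * H p.2 q.2 r.2 := by
  ext m
  rw [MvPowerSeries.coeff_mul, coeff_ofCoeff]
  simp_rw [coeff_ofCoeff, ← Finset.sum_product']
  let e (i j k : ℕ) : Fin 3 →₀ ℕ := Finsupp.equivFunOnFinite.symm ![i, j, k]
  refine Finset.sum_nbij'
    (fun p => ((p.1 0, p.2 0), ((p.1 1, p.2 1), (p.1 2, p.2 2))))
    (fun x => (e x.1.1 x.2.1.1 x.2.2.1, e x.1.2 x.2.1.2 x.2.2.2)) ?_ ?_ ?_ ?_ ?_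
  · rintro ⟨p, q⟩ h
    obtain rfl : p + q = m := by simpa using h
    simp
  · rintro ⟨⟨_, _⟩, ⟨_, _⟩, ⟨_, _⟩⟩ h
    simp only [Finset.mem_product, mem_antidiagonal] at h ⊢
    ext i
    fin_cases i <;> simp [e, h]
  · rintro ⟨p, q⟩ h
    ext i <;> fin_cases i <;> simp [e]
  · rintro ⟨⟨_, _⟩, ⟨_, _⟩, ⟨_, _⟩⟩ h
    simp [e]
  · rintro ⟨p, q⟩ h
    rfl

theorem coeff_inVariable (i : Fin 3) (f : PowerSeries (ZMod 2)) (m : Fin 3 →₀ ℕ) :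
    MvPowerSeries.coeff m (inVariable i f) =
      if m = Finsupp.single i (m i) then PowerSeries.coeff (m i) f else 0 := by
  let e : Unit ↪ Fin 3 := ⟨fun _ => i, fun _ _ _ => rfl⟩
  split_ifs with h
  · have := MvPowerSeries.coeff_embDomain_rename (R := ZMod 2) e f (Finsupp.single () (m i))
    rw [Finsupp.embDomain_single] at this
    rw [h]
    simpa [e] using! this
  · refine MvPowerSeries.coeff_rename_eq_zero _ _ ?_
    rintro ⟨x, rfl⟩
    apply h
    rw [Finsupp.unique_single x]
    simp

theorem inVariable_zero_eq (f : PowerSeries (ZMod 2)) : inVariable 0 f =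
    ofCoeff fun i j k => if j = 0 then if k = 0 then PowerSeries.coeff i f else 0 else 0 := by
  ext m
  rw [coeff_inVariable, coeff_ofCoeff, ← ite_and]
  refine if_congr ?_ rfl rfl
  simp [Finsupp.ext_iff, Fin.forall_fin_succ]

theorem inVariable_one_eq (f : PowerSeries (ZMod 2)) : inVariable 1 f =
    ofCoeff fun i j k => if i = 0 then if k = 0 then PowerSeries.coeff j f else 0 else 0 := by
  ext m
  rw [coeff_inVariable, coeff_ofCoeff, ← ite_and]
  refine if_congr ?_ rfl rfl
  simp [Finsupp.ext_iff, Fin.forall_fin_succ]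

theorem inVariable_two_eq (f : PowerSeries (ZMod 2)) : inVariable 2 f =
    ofCoeff fun i j k => if i = 0 then if j = 0 then PowerSeries.coeff k f else 0 else 0 := by
  ext m
  rw [coeff_inVariable, coeff_ofCoeff, ← ite_and]
  refine if_congr ?_ rfl rfl
  simp [Finsupp.ext_iff, Fin.forall_fin_succ]

section series

variable {T : Type*}

/-- The generating series of the values at the powers of a letter. -/
def lineSeries (a : T) (f : List T → ZMod 2) : PowerSeries (ZMod 2) :=
  PowerSeries.mk fun n => f (List.replicate n a)

/-- The generating series of the values at the words `a^i b^j`. -/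
def planeSeriesAB (a b : T) (f : List T → ZMod 2) : SeriesABC :=
  ofCoeff fun i j k => if k = 0 then f (List.replicate i a ++ List.replicate j b) else 0

/-- The generating series of the values at the words `b^j c^k`. -/
def planeSeriesBC (b c : T) (f : List T → ZMod 2) : SeriesABC :=
  ofCoeff fun i j k => if i = 0 then f (List.replicate j b ++ List.replicate k c) else 0

/-- The generating series of the values at the words `a^i b^j c^k`. -/
def spaceSeries (a b c : T) (f : List T → ZMod 2) : SeriesABC :=
  ofCoeff fun i j k => f (abcWord a b c i j k)

theorem lineSeries_conv (a : T) (f g : List T → ZMod 2) :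
    lineSeries a (conv f g) = lineSeries a f * lineSeries a g := by
  ext n
  simp [lineSeries, conv_replicate, PowerSeries.coeff_mul]

open Finset.HasAntidiagonal in
theorem sum_antidiagonal_ite_fst {M : Type*} [AddCommMonoid M] (n : ℕ) (h : ℕ × ℕ → M) :
    ∑ p ∈ antidiagonal n, (if p.1 = 0 then h p else 0) = h (0, n) := by
  rw [Finset.sum_eq_single (0, n)] <;> aesop

open Finset.HasAntidiagonal in
theorem sum_antidiagonal_ite_snd {M : Type*} [AddCommMonoid M] (n : ℕ) (h : ℕ × ℕ → M) :
    ∑ p ∈ antidiagonal n, (if p.2 = 0 then h p else 0) = h (n, 0) := by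
  rw [Finset.sum_eq_single (n, 0)] <;> aesop

theorem conv_replicate_append (f g : List T → ZMod 2) (a b : T) (i j : ℕ) :
    conv f g (List.replicate i a ++ List.replicate j b) +
        f (List.replicate i a) * g (List.replicate j b) =
      ∑ p ∈ Finset.HasAntidiagonal.antidiagonal i, f (List.replicate p.1 a) *
          g (List.replicate p.2 a ++ List.replicate j b) +
      ∑ q ∈ Finset.HasAntidiagonal.antidiagonal j,
          f (List.replicate i a ++ List.replicate q.1 b) * g (List.replicate q.2 b) := by
  rw [conv_append, conv_replicate, conv_replicate]

/-- The three sums are over cuts in the three blocks. The two extra terms on the left are the cuts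
at the two block boundaries, each of which occurs in two of the sums. -/
theorem conv_abcWord (f g : List T → ZMod 2) (a b c : T) (i j k : ℕ) :
    conv f g (abcWord a b c i j k) +
        f (List.replicate i a) * g (List.replicate j b ++ List.replicate k c) +
        f (List.replicate i a ++ List.replicate j b) * g (List.replicate k c) =
      ∑ p ∈ Finset.HasAntidiagonal.antidiagonal i, f (List.replicate p.1 a) *
          g (abcWord a b c p.2 j k) +
      ∑ q ∈ Finset.HasAntidiagonal.antidiagonal j,
          f (List.replicate i a ++ List.replicate q.1 b) *
          g (List.replicate q.2 b ++ List.replicate k c) +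
      ∑ r ∈ Finset.HasAntidiagonal.antidiagonal k,
          f (abcWord a b c i j r.1) * g (List.replicate r.2 c) := by
  have h1 := conv_append f g (List.replicate i a) (List.replicate j b ++ List.replicate k c)
  have h2 := conv_append (fun x => f (List.replicate i a ++ x)) g
    (List.replicate j b) (List.replicate k c)
  simp only [conv_replicate] at h1 h2
  simp only [abcWord, List.append_assoc]
  rw [h1, add_assoc, h2]
  ring

theorem planeSeriesAB_conv (a b : T) (f g : List T → ZMod 2) :
    planeSeriesAB a b (conv f g) +
        inVariable 0 (lineSeries a f) * inVariable 1 (lineSeries b g) =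
      inVariable 0 (lineSeries a f) * planeSeriesAB a b g +
        planeSeriesAB a b f * inVariable 1 (lineSeries b g) := by
  simp only [planeSeriesAB, inVariable_zero_eq, inVariable_one_eq, ofCoeff_mul, ofCoeff_add,
    lineSeries, PowerSeries.coeff_mk]
  congr 1
  ext i j k
  simp only [ite_mul, mul_ite, zero_mul, mul_zero, Finset.sum_ite_irrel, Finset.sum_const_zero,
    sum_antidiagonal_ite_fst, sum_antidiagonal_ite_snd]
  split_ifs with h
  · exact conv_replicate_append f g a b i j
  · simp

theorem planeSeriesBC_conv (b c : T) (f g : List T → ZMod 2) :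
    planeSeriesBC b c (conv f g) +
        inVariable 1 (lineSeries b f) * inVariable 2 (lineSeries c g) =
      inVariable 1 (lineSeries b f) * planeSeriesBC b c g +
        planeSeriesBC b c f * inVariable 2 (lineSeries c g) := by
  simp only [planeSeriesBC, inVariable_two_eq, inVariable_one_eq, ofCoeff_mul, ofCoeff_add,
    lineSeries, PowerSeries.coeff_mk]
  congr 1
  ext i j k
  simp only [ite_mul, mul_ite, zero_mul, mul_zero, Finset.sum_ite_irrel, Finset.sum_const_zero,
    sum_antidiagonal_ite_fst, sum_antidiagonal_ite_snd]
  split_ifs with h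
  · exact conv_replicate_append f g b c j k
  · simp

/-- Only two products contain a space series, and their other factors are line series in `a` and in
`c`. This is why the system for space series has coefficients in these two variables only. -/
theorem spaceSeries_conv (a b c : T) (f g : List T → ZMod 2) :
    spaceSeries a b c (conv f g) + inVariable 0 (lineSeries a f) * planeSeriesBC b c g +
        planeSeriesAB a b f * inVariable 2 (lineSeries c g) =
      inVariable 0 (lineSeries a f) * spaceSeries a b c g +
        planeSeriesAB a b f * planeSeriesBC b c g +
        spaceSeries a b c f * inVariable 2 (lineSeries c g) := by
  simp only [planeSeriesAB, planeSeriesBC, spaceSeries,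
    inVariable_zero_eq, inVariable_two_eq, ofCoeff_mul, ofCoeff_add,
    lineSeries, PowerSeries.coeff_mk]
  congr 1
  ext i j k
  simp only [ite_mul, mul_ite, zero_mul, mul_zero, Finset.sum_ite_irrel, Finset.sum_const_zero,
    sum_antidiagonal_ite_fst, sum_antidiagonal_ite_snd]
  exact conv_abcWord f g a b c i j k

end series

/-! ### Twisted derivations and linear systems -/

section jacobian

variable {σ R : Type*} [CommRing R]

open Classical in
/-- The partial derivative with respect to `s` of the noncommutative monomial `β`, where the
symbols to the left of `s` are evaluated by `P` and those to the right of `s` by `Q`. -/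
def jacobian (P Q : List σ → R) (s : σ) : List σ → R
  | [] => 0
  | X :: β => P [X] * jacobian P Q s β + if X = s then Q β else 0

theorem map_jacobian {S : Type*} [CommRing S] (φ : R →+* S) (P Q : List σ → R) (s : σ)
    (β : List σ) :
    φ (jacobian P Q s β) = jacobian (fun γ => φ (P γ)) (fun γ => φ (Q γ)) s β := by
  induction β with
  | nil => simp [jacobian]
  | cons X β ih => simp [jacobian, ih, apply_ite φ]

theorem jacobian_mem {S : Type*} [SetLike S R] [SubringClass S R] (F : S) {P Q : List σ → R}
    (hP : ∀ β, P β ∈ F) (hQ : ∀ β, Q β ∈ F) (s : σ) (β : List σ) : jacobian P Q s β ∈ F := by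
  induction β with
  | nil => exact zero_mem F
  | cons X β ih =>
    refine add_mem (mul_mem (hP _) ih) ?_
    split_ifs
    exacts [hQ _, zero_mem F]

/-- The chain rule for a twisted derivation modulo `V`. Here `V` is only an additive subgroup: in
the application to space series it is a ring that need not be closed under scalars from the ambient
field. -/
theorem sub_sum_jacobian_smul_mem {M ι : Type*} [AddCommGroup M] [Module R M] [Fintype ι]
    (V : AddSubgroup M) (e : ι → σ) (he : Function.Injective e) (P Q : List σ → R)
    (D : List σ → M) (hV : ∀ X, ∀ v ∈ V, P [X] • v ∈ V) (hnil : D [] ∈ V)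
    (hcons : ∀ X β, D (X :: β) - (P [X] • D β + Q β • D [X]) ∈ V)
    (hconst : ∀ X, X ∉ Set.range e → ∀ β, Q β • D [X] ∈ V) (β : List σ) :
    D β - ∑ i, jacobian P Q (e i) β • D [e i] ∈ V := by
  classical
  induction β with
  | nil => simpa [jacobian] using hnil
  | cons X β ih =>
    have h : ∑ i, jacobian P Q (e i) (X :: β) • D [e i] =
        P [X] • ∑ i, jacobian P Q (e i) β • D [e i] +
          ∑ i, (if X = e i then Q β else 0) • D [e i] := by
      simp [jacobian, add_smul, Finset.sum_add_distrib, Finset.smul_sum, mul_smul]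
    have h' : Q β • D [X] - ∑ i, (if X = e i then Q β else 0) • D [e i] ∈ V := by
      by_cases hX : X ∈ Set.range e
      · obtain ⟨i, rfl⟩ := hX
        simp [he.eq_iff, ite_smul]
      · have : ∀ i, X ≠ e i := fun i hi => hX ⟨i, hi.symm⟩
        simpa [this] using hconst X hX β
    rw [h]
    convert add_mem (add_mem (hcons X β) (hV X _ ih)) h' using 1
    rw [smul_sub]
    abel

end jacobian

/-- Write x = (1 - J)⁻¹(x - Jx); only the entries of the inverse have to preserve `V`. -/
theorem mem_of_sub_sum_smul_mem {L M ι : Type*} [Field L] [AddCommGroup M] [Module L M] [Fintype ι]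
    [DecidableEq ι] (V : AddSubgroup M) (J : Matrix ι ι L) (hdet : (1 - J).det ≠ 0)
    (hV : ∀ i j, ∀ v ∈ V, (1 - J)⁻¹ i j • v ∈ V) (x : ι → M)
    (hx : ∀ i, x i - ∑ j, J i j • x j ∈ V) (i : ι) : x i ∈ V := by
  have h : x i = ∑ k, (1 - J)⁻¹ i k • (x k - ∑ j, J k j • x j) := by
    have h1 : ∀ k, x k - ∑ j, J k j • x j = ∑ j, (1 - J) k j • x j := fun k => by
      simp [sub_smul, Finset.sum_sub_distrib, Matrix.one_apply, ite_smul]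
    have h2 : (1 - J)⁻¹ * (1 - J) = 1 := Matrix.nonsing_inv_mul _ hdet.isUnit
    simp_rw [h1, Finset.smul_sum, smul_smul]
    rw [Finset.sum_comm]
    simp_rw [← Finset.sum_smul, ← Matrix.mul_apply, h2]
    simp [Matrix.one_apply, ite_smul]
  rw [h]
  exact sum_mem fun k _ => hV i k _ (hx k)

theorem Subfield.inv_apply_mem {L ι : Type*} [Field L] [Fintype ι] [DecidableEq ι] (F : Subfield L)
    (A : Matrix ι ι L) (hA : ∀ i j, A i j ∈ F) (i j : ι) : A⁻¹ i j ∈ F := by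
  obtain ⟨B, rfl⟩ : ∃ B : Matrix ι ι F, A = F.subtype.mapMatrix B :=
    ⟨fun i j => ⟨A i j, hA i j⟩, rfl⟩
  rw [Matrix.inv_def, ← RingHom.map_det, ← RingHom.map_adjugate, Ring.inverse_eq_inv]
  exact mul_mem (inv_mem (SetLike.coe_mem _)) (SetLike.coe_mem _)

namespace GF2Grammar

variable {T : Type*} (G : GF2Grammar T)

/-- A productive nonterminal as a symbol. -/
def symbol (A : G.Productive) : Symbol T G.NT := .nonterminal A.1

theorem symbol_injective : Function.Injective G.symbol := fun A B h => by
  simpa [symbol, Subtype.ext_iff] using h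

/-- The matrix of the linear system for the productive nonterminals. -/
def systemMatrix {R : Type*} [CommRing R] (P Q : List (Symbol T G.NT) → R) :
    Matrix G.Productive G.Productive R :=
  fun A B => ∑ r ∈ G.rulesOf A.1, jacobian P Q (G.symbol B) r.output

/-- The Jacobian is a sum over the occurrences of `s` in `β`. A nonzero sum has a nonzero term, and
a count that is nonzero modulo 2 yields a forest. -/
theorem exists_eq_append_of_jacobian_ne_zero {s : Symbol T G.NT} {β : List (Symbol T G.NT)}
    (h : jacobian (fun γ => G.count γ []) (fun γ => G.count γ []) s β ≠ 0) :
    ∃ α γ, β = α ++ s :: γ ∧ Nonempty (ParseForest G.toContextFreeGrammar α []) ∧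
      Nonempty (ParseForest G.toContextFreeGrammar γ []) := by
  induction β with
  | nil => simp [jacobian] at h
  | cons X β ih =>
    rw [jacobian] at h
    by_cases h1 : G.count [X] [] * jacobian (fun γ => G.count γ []) (fun γ => G.count γ []) s β = 0
    · rw [h1, zero_add] at h
      split_ifs at h with hX
      · exact ⟨[], β, by simp [hX], ⟨.nil⟩, G.nonempty_of_count_ne_zero h⟩
      · exact absurd rfl h
    · obtain ⟨h2, h3⟩ := mul_ne_zero_iff.mp h1
      obtain ⟨α, γ, rfl, ⟨x⟩, hγ⟩ := ih h3
      obtain ⟨t⟩ := G.nonempty_of_count_ne_zero h2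
      obtain ⟨f, -⟩ := ParseForest.exists_append t x
      exact ⟨X :: α, γ, rfl, ⟨f⟩, hγ⟩

/-- A kernel vector satisfies v = Jv. Since J has nonzero entries only from `A` to nonterminals
below `A` in the well-founded order, induction gives v = 0. -/
theorem det_one_sub_systemMatrix_count_ne_zero [DecidableEq G.Productive] :
    (1 - G.systemMatrix (fun γ => G.count γ []) (fun γ => G.count γ [])).det ≠ 0 := by
  intro h
  obtain ⟨v, hv, h⟩ := Matrix.exists_mulVec_eq_zero_iff.mpr h
  refine hv (funext fun A => ?_)
  induction A using G.wellFounded_emptyContext.induction with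
  | _ A ih =>
    rw [Matrix.sub_mulVec, Matrix.one_mulVec, sub_eq_zero] at h
    rw [h]
    refine Finset.sum_eq_zero fun B _ => ?_
    by_cases hB : G.systemMatrix (fun γ => G.count γ []) (fun γ => G.count γ []) A B = 0
    · simp [hB]
    · obtain ⟨r, hr, hne⟩ := Finset.exists_ne_zero_of_sum_ne_zero hB
      obtain ⟨α, γ, h⟩ := G.exists_eq_append_of_jacobian_ne_zero hne
      simp [ih B ⟨r, hr, α, γ, h⟩]

theorem det_one_sub_systemMatrix_map [DecidableEq G.Productive] {R S : Type*} [CommRing R]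
    [CommRing S] (φ : R →+* S) (P Q : List (Symbol T G.NT) → R) :
    (1 - G.systemMatrix (fun γ => φ (P γ)) (fun γ => φ (Q γ))).det =
      φ (1 - G.systemMatrix P Q).det := by
  have h : φ.mapMatrix (G.systemMatrix P Q) =
      G.systemMatrix (fun γ => φ (P γ)) (fun γ => φ (Q γ)) := by
    ext A B
    simp [systemMatrix, map_jacobian]
  rw [RingHom.map_det, map_sub, map_one, h]

/-- If the determinant vanished, so would its image under `ψ`, the constant coefficient in
applications. That image is the determinant for empty yields. -/
theorem det_one_sub_systemMatrix_ne_zero [DecidableEq G.Productive] {S L : Type*} [CommRing S]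
    [CommRing L] (φ : S →+* L) (hφ : Function.Injective φ) (ψ : S →+* ZMod 2)
    (P Q : List (Symbol T G.NT) → S) (hP : ∀ γ, ψ (P γ) = G.count γ [])
    (hQ : ∀ γ, ψ (Q γ) = G.count γ []) :
    (1 - G.systemMatrix (fun γ => φ (P γ)) (fun γ => φ (Q γ))).det ≠ 0 := by
  intro h0
  rw [det_one_sub_systemMatrix_map, map_eq_zero_iff φ hφ] at h0
  apply G.det_one_sub_systemMatrix_count_ne_zero
  have := G.det_one_sub_systemMatrix_map ψ P Q
  simpa only [hP, hQ, h0, map_zero] using this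

theorem mem_of_linear_system [DecidableEq G.Productive] {L M : Type*} [Field L] [AddCommGroup M]
    [Module L M] (V : AddSubgroup M) (P Q : List (Symbol T G.NT) → L)
    (hdet : (1 - G.systemMatrix P Q).det ≠ 0) (D : List (Symbol T G.NT) → M)
    (hinv : ∀ A B, ∀ v ∈ V, (1 - G.systemMatrix P Q)⁻¹ A B • v ∈ V)
    (hV : ∀ X, ∀ v ∈ V, P [X] • v ∈ V) (hnil : D [] ∈ V)
    (hcons : ∀ X β, D (X :: β) - (P [X] • D β + Q β • D [X]) ∈ V)
    (hconst : ∀ X, X ∉ Set.range G.symbol → ∀ β, Q β • D [X] ∈ V)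
    (hrule : ∀ A : G.Productive, D [G.symbol A] = ∑ r ∈ G.rulesOf A.1, D r.output)
    (A : G.Productive) : D [G.symbol A] ∈ V := by
  refine mem_of_sub_sum_smul_mem V _ hdet hinv (fun A => D [G.symbol A]) (fun A => ?_) A
  have h : D [G.symbol A] - ∑ B, G.systemMatrix P Q A B • D [G.symbol B] =
      ∑ r ∈ G.rulesOf A.1, (D r.output - ∑ B, jacobian P Q (G.symbol B) r.output •
        D [G.symbol B]) := by
    rw [Finset.sum_sub_distrib, ← hrule, Finset.sum_comm]
    simp [systemMatrix, Finset.sum_smul]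
  simp only [h]
  exact sum_mem fun r _ => sub_sum_jacobian_smul_mem V G.symbol G.symbol_injective P Q D hV hnil
    hcons hconst r.output

end GF2Grammar

/-! ### Algebraicity of line series through Kähler differentials -/

theorem formallyUnramified_adjoin_of_derivation_eq_zero {K L : Type*} [Field K] [Field L]
    [Algebra K L] (s : Set L)
    (h : ∀ x, ∀ hx : x ∈ IntermediateField.adjoin K s, x ∈ s →
      KaehlerDifferential.D K (IntermediateField.adjoin K s) ⟨x, hx⟩ = 0) :
    Algebra.FormallyUnramified K (IntermediateField.adjoin K s) := by
  let D := KaehlerDifferential.D K (IntermediateField.adjoin K s)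
  have key : ∀ x (hx : x ∈ IntermediateField.adjoin K s), D ⟨x, hx⟩ = 0 := by
    intro x hx
    induction hx using IntermediateField.adjoin_induction with
    | mem x hx => exact h x _ hx
    | algebraMap x => exact D.map_algebraMap x
    | add x y hx hy ihx ihy =>
      have := D.map_add ⟨x, hx⟩ ⟨y, hy⟩
      rwa [ihx, ihy, add_zero] at this
    | inv x hx ih =>
      have := D.leibniz_inv ⟨x, hx⟩
      rwa [ih, smul_zero] at this
    | mul x y hx hy ihx ihy =>
      have := D.leibniz ⟨x, hx⟩ ⟨y, hy⟩
      rwa [ihx, ihy, smul_zero, smul_zero, add_zero] at this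
  refine ⟨?_⟩
  have h1 := KaehlerDifferential.span_range_derivation K (IntermediateField.adjoin K s)
  have h2 : Set.range D ⊆ {0} := by
    rintro _ ⟨⟨x, hx⟩, rfl⟩
    exact key x hx
  refine (Submodule.subsingleton_iff (IntermediateField.adjoin K s)).mp ?_
  refine subsingleton_of_bot_eq_top ?_
  rw [← h1, eq_comm, Submodule.span_eq_bot]
  exact fun x hx => h2 hx

namespace GF2Grammar

variable {T : Type*} (G : GF2Grammar T)

/-- A Jacobian criterion: differentiating the polynomial system gives a homogeneous linear system
with invertible matrix for the differentials of the unknowns, so all differentials of the generated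
field vanish. -/
theorem isAlgebraic_of_system [DecidableEq G.Productive] {K L : Type*} [Field K] [Field L]
    [Algebra K L] (p : List (Symbol T G.NT) → L) (hdet : (1 - G.systemMatrix p p).det ≠ 0)
    (hnil : p [] = 1) (hcons : ∀ X β, p (X :: β) = p [X] * p β)
    (hconst : ∀ X, X ∉ Set.range G.symbol → p [X] ∈ (algebraMap K L).range)
    (hrule : ∀ A : G.Productive, p [G.symbol A] = ∑ r ∈ G.rulesOf A.1, p r.output)
    (β : List (Symbol T G.NT)) : IsAlgebraic K (p β) := by
  let s := Set.range fun A : G.Productive => p [G.symbol A]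
  let E := IntermediateField.adjoin K s
  have hmem : ∀ β, p β ∈ E := by
    intro β
    induction β with
    | nil => rw [hnil]; exact one_mem E
    | cons X β ih =>
      rw [hcons]
      refine mul_mem ?_ ih
      by_cases hX : X ∈ Set.range G.symbol
      · obtain ⟨A, rfl⟩ := hX
        exact IntermediateField.subset_adjoin K s ⟨A, rfl⟩
      · obtain ⟨y, hy⟩ := hconst X hX
        rw [← hy]
        exact E.algebraMap_mem y
  let q : List (Symbol T G.NT) → E := fun β => ⟨p β, hmem β⟩
  have hdet' : (1 - G.systemMatrix q q).det ≠ 0 := by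
    intro h0
    have := G.det_one_sub_systemMatrix_map (algebraMap E L) q q
    rw [h0, map_zero] at this
    exact hdet this
  let D := KaehlerDifferential.D K E
  have hD : ∀ A : G.Productive, D (q [G.symbol A]) = 0 := by
    intro A
    refine AddSubgroup.mem_bot.mp (G.mem_of_linear_system ⊥ q q hdet' (fun β => D (q β))
      ?_ ?_ ?_ ?_ ?_ ?_ A)
    · rintro A B v hv
      rw [AddSubgroup.mem_bot.mp hv, smul_zero]
      exact zero_mem _
    · rintro A v hv
      rw [AddSubgroup.mem_bot.mp hv, smul_zero]
      exact zero_mem _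
    · have : q [] = 1 := Subtype.ext hnil
      simp [this]
    · intro X β
      have : q (X :: β) = q [X] * q β := Subtype.ext (hcons X β)
      simp [this]
    · intro X hX β
      obtain ⟨y, hy⟩ := hconst X hX
      have : q [X] = algebraMap K E y := Subtype.ext hy.symm
      simp [this]
    · intro A
      have : q [G.symbol A] = ∑ r ∈ G.rulesOf A.1, q r.output :=
        Subtype.ext (by simpa [q] using hrule A)
      simp [this]
  have h1 : Algebra.FormallyUnramified K E := by
    refine formallyUnramified_adjoin_of_derivation_eq_zero s ?_
    rintro _ hx ⟨A, rfl⟩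
    exact hD A
  -- Finite generation is essential: in characteristic p, vanishing differentials alone do not force
  -- an extension to be algebraic.
  have h2 : Algebra.EssFiniteType K E :=
    IntermediateField.essFiniteType_iff.mpr
      (IntermediateField.fg_adjoin_of_finite (Set.finite_range _))
  have h3 := (Algebra.FormallyUnramified.iff_isSeparable K E).mp h1
  have h4 : IsAlgebraic K (q β) := Algebra.IsAlgebraic.isAlgebraic _
  exact h4.algebraMap

theorem count_nil_eq_ite_length (w : List T) :
    G.count [] w = if w.length = 0 then 1 else 0 := by
  classical
  rw [count_nil]
  simp

/-- The generating series of the words over a single letter that are described by `β`. -/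
def lineCount (a : T) (β : List (Symbol T G.NT)) : PowerSeries (ZMod 2) :=
  lineSeries a (G.count β)

theorem constantCoeff_lineCount (a : T) (β : List (Symbol T G.NT)) :
    PowerSeries.constantCoeff (G.lineCount a β) = G.count β [] := by
  simp [lineCount, lineSeries, ← PowerSeries.coeff_zero_eq_constantCoeff_apply]

theorem lineCount_nil (a : T) : G.lineCount a [] = 1 := by
  ext n
  simp [lineCount, lineSeries, count_nil_eq_ite_length, PowerSeries.coeff_one]

theorem lineCount_cons (a : T) (X : Symbol T G.NT) (β : List (Symbol T G.NT)) :
    G.lineCount a (X :: β) = G.lineCount a [X] * G.lineCount a β := by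
  rw [lineCount, count_cons, lineSeries_conv]
  rfl

open Classical in
theorem lineCount_terminal (a t : T) :
    G.lineCount a [.terminal t] = if t = a then PowerSeries.X else 0 := by
  ext n
  simp only [lineCount, lineSeries, PowerSeries.coeff_mk, count_terminal]
  rcases n with _ | _ | n
  · split_ifs <;> simp_all
  · split_ifs <;> simp_all [PowerSeries.coeff_X]
  · split_ifs <;> simp_all [PowerSeries.coeff_X, List.replicate_succ]

theorem lineCount_of_not_productive (a : T) (A : G.NT)
    (hA : ¬∃ w, Nonempty (ParseTree G.toContextFreeGrammar A w)) :
    G.lineCount a [.nonterminal A] = 0 := by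
  ext n
  simp [lineCount, lineSeries, G.count_eq_zero_of_not_productive A hA]

theorem lineCount_symbol (a : T) (A : G.Productive) :
    G.lineCount a [G.symbol A] = ∑ r ∈ G.rulesOf A.1, G.lineCount a r.output := by
  ext n
  simp [lineCount, lineSeries, symbol, count_nonterminal]

/-- A symbol that is not a productive nonterminal is a terminal or a nonterminal without
parse trees. -/
theorem terminal_or_not_productive {X : Symbol T G.NT} (hX : X ∉ Set.range G.symbol) :
    (∃ t, X = .terminal t) ∨ ∃ A, X = .nonterminal A ∧
      ¬∃ w, Nonempty (ParseTree G.toContextFreeGrammar A w) := by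
  cases X with
  | terminal t => exact .inl ⟨t, rfl⟩
  | nonterminal A => exact .inr ⟨A, rfl, fun h => hX ⟨⟨A, h⟩, rfl⟩⟩

open scoped RatFunc in
theorem isAlgebraic_lineCount (a : T) (β : List (Symbol T G.NT)) :
    IsAlgebraic (Polynomial (ZMod 2)) (G.lineCount a β) := by
  classical
  have : IsScalarTower (Polynomial (ZMod 2)) (PowerSeries (ZMod 2)) (LaurentSeries (ZMod 2)) :=
    .of_algebraMap_eq fun _ => rfl
  let φ := algebraMap (PowerSeries (ZMod 2)) (LaurentSeries (ZMod 2))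
  have hφ : Function.Injective φ := IsFractionRing.injective _ _
  refine (isAlgebraic_algebraMap_iff hφ).mp ?_
  rw [IsFractionRing.isAlgebraic_iff (Polynomial (ZMod 2)) (RatFunc (ZMod 2))]
  refine G.isAlgebraic_of_system (fun β => φ (G.lineCount a β)) ?_ ?_ ?_ ?_ ?_ β
  · exact G.det_one_sub_systemMatrix_ne_zero φ hφ PowerSeries.constantCoeff _ _
      (G.constantCoeff_lineCount a) (G.constantCoeff_lineCount a)
  · rw [lineCount_nil, map_one]
  · intro X β
    rw [lineCount_cons, map_mul]
  · intro X hX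
    obtain ⟨t, rfl⟩ | ⟨A, rfl, hA⟩ := G.terminal_or_not_productive hX
    · rw [lineCount_terminal]
      split_ifs
      · refine ⟨algebraMap (Polynomial (ZMod 2)) _ Polynomial.X, ?_⟩
        rw [← IsScalarTower.algebraMap_apply, IsScalarTower.algebraMap_apply _
          (PowerSeries (ZMod 2)) (LaurentSeries (ZMod 2))]
        congr 1
        exact Polynomial.coe_X
      · rw [map_zero]
        exact zero_mem _
    · rw [G.lineCount_of_not_productive a A hA, map_zero]
      exact zero_mem _
  · intro A
    rw [lineCount_symbol, map_sum]

end GF2Grammar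

/-! ### The ring of admissible fractions and the two-variable fields -/

/-- Substitution of the `i`-th variable into a power series in one variable. -/
def inVariableHom (i : Fin 3) : PowerSeries (ZMod 2) →+* SeriesABC :=
  (MvPowerSeries.rename (R := ZMod 2) (fun _ : Unit => i)).toRingHom

theorem inVariableHom_injective (i : Fin 3) : Function.Injective (inVariableHom i) :=
  MvPowerSeries.rename_injective (R := ZMod 2) ⟨fun _ : Unit => i, fun _ _ _ => rfl⟩

theorem inVariableHom_X (i : Fin 3) : inVariableHom i PowerSeries.X = MvPowerSeries.X i :=
  MvPowerSeries.rename_X (R := ZMod 2) (fun _ : Unit => i) ()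

theorem inVariableHom_C (i : Fin 3) (r : ZMod 2) :
    inVariableHom i (PowerSeries.C r) = MvPowerSeries.C r :=
  MvPowerSeries.rename_C (R := ZMod 2) (fun _ : Unit => i) r

theorem constantCoeff_inVariableHom (i : Fin 3) (f : PowerSeries (ZMod 2)) :
    MvPowerSeries.constantCoeff (inVariableHom i f) = PowerSeries.constantCoeff f :=
  MvPowerSeries.constantCoeff_rename (R := ZMod 2) (fun _ : Unit => i) f

/-- The ring of algebraic power series in the `i`-th variable. -/
def algebraicSubring (i : Fin 3) : Subring SeriesABC :=
  (Subalgebra.algebraicClosure (Polynomial (ZMod 2)) (PowerSeries (ZMod 2))).toSubring.map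
    (inVariableHom i)

theorem mem_algebraicSubring {i : Fin 3} {F : SeriesABC} :
    F ∈ algebraicSubring i ↔ F ∈ algebraicSeries i := by
  constructor
  · rintro ⟨f, hf, rfl⟩
    exact ⟨f, hf, rfl⟩
  · rintro ⟨f, hf, rfl⟩
    exact ⟨f, hf, rfl⟩

theorem inVariableHom_coe_mem_algebraicSubring (i : Fin 3) (p : Polynomial (ZMod 2)) :
    inVariableHom i p ∈ algebraicSubring i :=
  ⟨p, isAlgebraic_algebraMap (A := PowerSeries (ZMod 2)) p, rfl⟩

theorem C_mem_algebraicSubring (i : Fin 3) (r : ZMod 2) :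
    (MvPowerSeries.C r : SeriesABC) ∈ algebraicSubring i := by
  simpa [inVariableHom_C] using inVariableHom_coe_mem_algebraicSubring i (Polynomial.C r)

theorem X_mem_algebraicSubring (i : Fin 3) :
    (MvPowerSeries.X i : SeriesABC) ∈ algebraicSubring i := by
  simpa [inVariableHom_X] using inVariableHom_coe_mem_algebraicSubring i Polynomial.X

/-- The ring of sums of products of algebraic power series in the single variables. -/
def tripleSubring : Subring SeriesABC where
  carrier := {x | ∃ (ι : Type) (_ : Fintype ι) (A B C : ι → SeriesABC),
    (∀ i, A i ∈ algebraicSubring 0) ∧ (∀ i, B i ∈ algebraicSubring 1) ∧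
    (∀ i, C i ∈ algebraicSubring 2) ∧ x = ∑ i, A i * B i * C i}
  zero_mem' := ⟨Empty, inferInstance, 0, 0, 0, by simp, by simp, by simp, by simp⟩
  one_mem' := ⟨Unit, inferInstance, 1, 1, 1, fun _ => one_mem _, fun _ => one_mem _,
    fun _ => one_mem _, by simp⟩
  add_mem' := by
    rintro _ _ ⟨ι, _, A, B, C, hA, hB, hC, rfl⟩ ⟨κ, _, A', B', C', hA', hB', hC', rfl⟩
    refine ⟨ι ⊕ κ, inferInstance, Sum.elim A A', Sum.elim B B', Sum.elim C C', ?_, ?_, ?_, ?_⟩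
    · rintro (i | i); exacts [hA i, hA' i]
    · rintro (i | i); exacts [hB i, hB' i]
    · rintro (i | i); exacts [hC i, hC' i]
    · simp
  mul_mem' := by
    rintro _ _ ⟨ι, _, A, B, C, hA, hB, hC, rfl⟩ ⟨κ, _, A', B', C', hA', hB', hC', rfl⟩
    refine ⟨ι × κ, inferInstance, fun p => A p.1 * A' p.2, fun p => B p.1 * B' p.2,
      fun p => C p.1 * C' p.2, fun p => mul_mem (hA _) (hA' _), fun p => mul_mem (hB _) (hB' _),
      fun p => mul_mem (hC _) (hC' _), ?_⟩
    rw [Fintype.sum_mul_sum, Fintype.sum_prod_type]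
    refine Finset.sum_congr rfl fun i _ => Finset.sum_congr rfl fun j _ => ?_
    ring
  neg_mem' := by
    rintro _ ⟨ι, _, A, B, C, hA, hB, hC, rfl⟩
    exact ⟨ι, inferInstance, -A, B, C, fun i => neg_mem (hA i), hB, hC, by simp⟩

theorem algebraicSubring_le_tripleSubring (i : Fin 3) : algebraicSubring i ≤ tripleSubring := by
  intro x hx
  have h1 (j : Fin 3) : ∀ _ : Unit, (1 : SeriesABC) ∈ algebraicSubring j := fun _ => one_mem _
  fin_cases i
  · exact ⟨Unit, inferInstance, fun _ => x, 1, 1, fun _ => hx, h1 1, h1 2, by simp⟩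
  · exact ⟨Unit, inferInstance, 1, fun _ => x, 1, h1 0, fun _ => hx, h1 2, by simp⟩
  · exact ⟨Unit, inferInstance, 1, 1, fun _ => x, h1 0, h1 1, fun _ => hx, by simp⟩

theorem coe_mem_tripleSubring (p : MvPolynomial (Fin 3) (ZMod 2)) :
    (p : SeriesABC) ∈ tripleSubring := by
  induction p using MvPolynomial.induction_on with
  | C r =>
    rw [MvPolynomial.coe_C]
    exact algebraicSubring_le_tripleSubring 0 (C_mem_algebraicSubring 0 r)
  | add p q hp hq =>
    rw [MvPolynomial.coe_add]
    exact add_mem hp hq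
  | mul_X p i hp =>
    rw [MvPolynomial.coe_mul, MvPolynomial.coe_X]
    exact mul_mem hp (algebraicSubring_le_tripleSubring i (X_mem_algebraicSubring i))

theorem nonzeroPoly_subset_tripleSubring {i j : Fin 3} {P : SeriesABC} (h : P ∈ nonzeroPoly i j) :
    P ∈ tripleSubring := by
  obtain ⟨p, -, -, rfl⟩ := h
  exact coe_mem_tripleSubring p

theorem one_mem_nonzeroPoly (i j : Fin 3) : 1 ∈ nonzeroPoly i j :=
  ⟨1, one_mem _, one_ne_zero, by simp⟩

theorem mul_mem_nonzeroPoly {i j : Fin 3} {P Q : SeriesABC} (hP : P ∈ nonzeroPoly i j)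
    (hQ : Q ∈ nonzeroPoly i j) : P * Q ∈ nonzeroPoly i j := by
  obtain ⟨p, hp, hp0, rfl⟩ := hP
  obtain ⟨q, hq, hq0, rfl⟩ := hQ
  exact ⟨p * q, mul_mem hp hq, mul_ne_zero hp0 hq0, by simp⟩

theorem ne_zero_of_mem_nonzeroPoly {i j : Fin 3} {P : SeriesABC} (hP : P ∈ nonzeroPoly i j) :
    P ≠ 0 := by
  obtain ⟨p, -, hp0, rfl⟩ := hP
  simpa using hp0

/-- Products of nonzero polynomials that depend on two variables each. -/
def denominators : Submonoid SeriesABC where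
  carrier := {d | ∃ p ∈ nonzeroPoly 0 1, ∃ q ∈ nonzeroPoly 0 2, ∃ r ∈ nonzeroPoly 1 2,
    d = p * q * r}
  one_mem' := ⟨1, one_mem_nonzeroPoly _ _, 1, one_mem_nonzeroPoly _ _, 1,
    one_mem_nonzeroPoly _ _, by simp⟩
  mul_mem' := by
    rintro _ _ ⟨p, hp, q, hq, r, hr, rfl⟩ ⟨p', hp', q', hq', r', hr', rfl⟩
    exact ⟨_, mul_mem_nonzeroPoly hp hp', _, mul_mem_nonzeroPoly hq hq', _,
      mul_mem_nonzeroPoly hr hr', by ring⟩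

theorem denominators_le : (denominators : Set SeriesABC) ⊆ tripleSubring := by
  rintro _ ⟨p, hp, q, hq, r, hr, rfl⟩
  exact mul_mem (mul_mem (nonzeroPoly_subset_tripleSubring hp)
    (nonzeroPoly_subset_tripleSubring hq)) (nonzeroPoly_subset_tripleSubring hr)

theorem ne_zero_of_mem_denominators {d : SeriesABC} (hd : d ∈ denominators) : d ≠ 0 := by
  obtain ⟨p, hp, q, hq, r, hr, rfl⟩ := hd
  exact mul_ne_zero (mul_ne_zero (ne_zero_of_mem_nonzeroPoly hp) (ne_zero_of_mem_nonzeroPoly hq))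
    (ne_zero_of_mem_nonzeroPoly hr)

theorem nonzeroPoly_subset_denominators {i j : Fin 3} (hij : i < j) {P : SeriesABC}
    (h : P ∈ nonzeroPoly i j) : P ∈ denominators := by
  have h1 := one_mem_nonzeroPoly
  fin_cases i <;> fin_cases j <;> simp at hij
  · exact ⟨P, h, 1, h1 _ _, 1, h1 _ _, by simp⟩
  · exact ⟨1, h1 _ _, P, h, 1, h1 _ _, by simp⟩
  · exact ⟨1, h1 _ _, 1, h1 _ _, P, h, by simp⟩

section field

variable {L : Type*} [Field L] (φ : SeriesABC →+* L)

theorem map_ne_zero_of_mem_denominators (hφ : Function.Injective φ) {d : SeriesABC} (hd : d ∈ denominators) : φ d ≠ 0 :=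
  (map_ne_zero_iff φ hφ).mpr (ne_zero_of_mem_denominators hd)

/-- The ring of fractions whose numerators are in `tripleSubring` and whose denominators are
products of polynomials in two variables. -/
def fractionSubring (hφ : Function.Injective φ) : Subring L where
  carrier := {x | ∃ s ∈ tripleSubring, ∃ d ∈ denominators, x = φ s / φ d}
  zero_mem' := ⟨0, zero_mem _, 1, one_mem _, by simp⟩
  one_mem' := ⟨1, one_mem _, 1, one_mem _, by simp⟩
  add_mem' := by
    rintro _ _ ⟨s, hs, d, hd, rfl⟩ ⟨s', hs', d', hd', rfl⟩
    refine ⟨s * d' + d * s', add_mem (mul_mem hs (denominators_le hd'))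
      (mul_mem (denominators_le hd) hs'), d * d', mul_mem hd hd', ?_⟩
    rw [div_add_div _ _ (map_ne_zero_of_mem_denominators φ hφ hd)
      (map_ne_zero_of_mem_denominators φ hφ hd')]
    simp
  mul_mem' := by
    rintro _ _ ⟨s, hs, d, hd, rfl⟩ ⟨s', hs', d', hd', rfl⟩
    exact ⟨s * s', mul_mem hs hs', d * d', mul_mem hd hd', by
      rw [div_mul_div_comm, map_mul, map_mul]⟩
  neg_mem' := by
    rintro _ ⟨s, hs, d, hd, rfl⟩
    exact ⟨-s, neg_mem hs, d, hd, by rw [map_neg, neg_div]⟩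

/-- The ring of polynomials in the `i`-th and the `j`-th variable. -/
def polySubring (i j : Fin 3) : Subring SeriesABC :=
  (MvPolynomial.supported (ZMod 2) ({i, j} : Set (Fin 3))).toSubring.map
    MvPolynomial.coeToMvPowerSeries.ringHom

/-- The field of rational functions in the `i`-th and the `j`-th variable. -/
def rationalSubfield (i j : Fin 3) : Subfield L := Subfield.closure ((polySubring i j).map φ)

theorem map_mem_rationalSubfield {i j : Fin 3} {p : SeriesABC} (hp : p ∈ polySubring i j) :
    φ p ∈ rationalSubfield φ i j :=
  Subfield.subset_closure ⟨p, hp, rfl⟩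

theorem rationalSubfield_le (hφ : Function.Injective φ) {i j : Fin 3} (hij : i < j) {x : L}
    (hx : x ∈ rationalSubfield φ i j) : x ∈ fractionSubring φ hφ := by
  obtain ⟨y, hy, z, hz, rfl⟩ := Subfield.mem_closure_iff.mp hx
  rw [Subring.closure_eq] at hy hz
  obtain ⟨_, ⟨p, hp, rfl⟩, rfl⟩ := hy
  obtain ⟨_, ⟨q, hq, rfl⟩, rfl⟩ := hz
  by_cases hq0 : q = 0
  · simp [hq0, zero_mem]
  · exact ⟨_, coe_mem_tripleSubring p, _, nonzeroPoly_subset_denominators hij ⟨q, hq, hq0, rfl⟩,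
      rfl⟩

/-- The field generated by the algebraic power series in the `i`-th and those in the `j`-th
variable, over the rational functions in these variables. -/
def algebraicSubfield (i j : Fin 3) : Subfield L :=
  (IntermediateField.adjoin (rationalSubfield φ i j)
    (φ '' (algebraicSubring i ∪ algebraicSubring j))).toSubfield

theorem map_mem_algebraicSubfield_left {i j : Fin 3} {x : SeriesABC} (hx : x ∈ algebraicSubring i) :
    φ x ∈ algebraicSubfield φ i j :=
  IntermediateField.subset_adjoin _ _ ⟨x, .inl hx, rfl⟩

theorem map_mem_algebraicSubfield_right {i j : Fin 3} {x : SeriesABC}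
    (hx : x ∈ algebraicSubring j) : φ x ∈ algebraicSubfield φ i j :=
  IntermediateField.subset_adjoin _ _ ⟨x, .inr hx, rfl⟩

theorem inVariableHom_coe_mem_polySubring {i j l : Fin 3} (hl : l ∈ ({i, j} : Set (Fin 3)))
    (p : Polynomial (ZMod 2)) : inVariableHom l (p : PowerSeries (ZMod 2)) ∈ polySubring i j := by
  induction p using Polynomial.induction_on' with
  | add p q hp hq =>
    rw [Polynomial.coe_add, map_add]
    exact add_mem hp hq
  | monomial n r =>
    rw [← Polynomial.C_mul_X_pow_eq_monomial, Polynomial.coe_mul, Polynomial.coe_pow,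
      Polynomial.coe_C, Polynomial.coe_X, map_mul, map_pow, inVariableHom_C, inVariableHom_X]
    have hC : MvPowerSeries.C r ∈ polySubring i j :=
      ⟨MvPolynomial.C r, (MvPolynomial.supported (ZMod 2) ({i, j} : Set (Fin 3))).algebraMap_mem r,
        MvPolynomial.coe_C r⟩
    have hX : MvPowerSeries.X l ∈ polySubring i j :=
      ⟨MvPolynomial.X l, Algebra.subset_adjoin ⟨l, hl, rfl⟩, MvPolynomial.coe_X l⟩
    exact mul_mem hC (pow_mem hX n)

theorem isAlgebraic_of_mem_algebraicSubring (hφ : Function.Injective φ) {i j l : Fin 3}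
    (hl : l ∈ ({i, j} : Set (Fin 3)))
    {x : SeriesABC} (hx : x ∈ algebraicSubring l) :
    IsAlgebraic (rationalSubfield φ i j) (φ x) := by
  obtain ⟨f, hf, rfl⟩ := hx
  let ψ : PowerSeries (ZMod 2) →+* L := φ.comp (inVariableHom l)
  let θ : Polynomial (ZMod 2) →+* rationalSubfield φ i j :=
    (ψ.comp Polynomial.coeToPowerSeries.ringHom).codRestrict _ fun p =>
      map_mem_rationalSubfield φ (inVariableHom_coe_mem_polySubring hl p)
  have hψ : Function.Injective ψ := hφ.comp (inVariableHom_injective l)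
  refine IsAlgebraic.ringHom_of_comp_eq θ ψ hf ?_ ?_
  · intro p q hpq
    have : ψ p = ψ q := congrArg Subtype.val hpq
    exact Polynomial.coe_injective _ (hψ this)
  · ext <;> rfl

/-- Adjoining algebraic elements as a field or as a ring gives the same result, so no inverses of
algebraic series are needed: the only denominators come from the rational functions. -/
theorem algebraicSubfield_le (hφ : Function.Injective φ) {i j : Fin 3} (hij : i < j) {x : L}
    (hx : x ∈ algebraicSubfield φ i j) : x ∈ fractionSubring φ hφ := by
  have halg : ∀ y ∈ φ '' (algebraicSubring i ∪ algebraicSubring j),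
      IsAlgebraic (rationalSubfield φ i j) y := by
    rintro _ ⟨y, hy | hy, rfl⟩
    · exact isAlgebraic_of_mem_algebraicSubring φ hφ (by simp) hy
    · exact isAlgebraic_of_mem_algebraicSubring φ hφ (by simp) hy
  have hx' : x ∈ Algebra.adjoin (rationalSubfield φ i j)
      (φ '' (algebraicSubring i ∪ algebraicSubring j)) := by
    rw [← IntermediateField.adjoin_toSubalgebra_of_isAlgebraic halg]
    exact hx
  clear hx
  induction hx' using Algebra.adjoin_induction with
  | mem y hy =>
    obtain ⟨y, hy, rfl⟩ := hy
    refine ⟨y, ?_, 1, one_mem _, by simp⟩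
    exact hy.elim (fun h => algebraicSubring_le_tripleSubring i h)
      (fun h => algebraicSubring_le_tripleSubring j h)
  | algebraMap r => exact rationalSubfield_le φ hφ hij r.2
  | add y z hy hz ihy ihz => exact add_mem ihy ihz
  | mul y z hy hz ihy ihz => exact mul_mem ihy ihz

end field

theorem mem_RABC_of_mem_fractionSubring
    (h : Function.Injective (algebraMap SeriesABC LaurentABC)) {x : LaurentABC}
    (hx : x ∈ fractionSubring (algebraMap SeriesABC LaurentABC) h) : x ∈ RABC := by
  obtain ⟨_, ⟨ι, _, A, B, C, hA, hB, hC, rfl⟩, _, ⟨p, hp, q, hq, r, hr, rfl⟩, rfl⟩ := hx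
  let e := (Fintype.equivFin ι).symm
  refine ⟨Fintype.card ι, A ∘ e, B ∘ e, C ∘ e, p, q, r,
    fun i => mem_algebraicSubring.mp (hA _), fun i => mem_algebraicSubring.mp (hB _),
    fun i => mem_algebraicSubring.mp (hC _), hp, hq, hr, ?_⟩
  rw [← e.sum_comp]
  rfl

/-! ### Series of the empty string and of single terminals -/

variable {T : Type*}

theorem planeSeriesAB_sum (a b : T) {ι : Type*} (s : Finset ι) (f : ι → List T → ZMod 2) :
    planeSeriesAB a b (fun w => ∑ i ∈ s, f i w) = ∑ i ∈ s, planeSeriesAB a b (f i) := by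
  ext m
  simp only [planeSeriesAB, map_sum, coeff_ofCoeff]
  split_ifs <;> simp

theorem planeSeriesBC_sum (b c : T) {ι : Type*} (s : Finset ι) (f : ι → List T → ZMod 2) :
    planeSeriesBC b c (fun w => ∑ i ∈ s, f i w) = ∑ i ∈ s, planeSeriesBC b c (f i) := by
  ext m
  simp only [planeSeriesBC, map_sum, coeff_ofCoeff]
  split_ifs <;> simp

theorem spaceSeries_sum (a b c : T) {ι : Type*} (s : Finset ι) (f : ι → List T → ZMod 2) :
    spaceSeries a b c (fun w => ∑ i ∈ s, f i w) = ∑ i ∈ s, spaceSeries a b c (f i) := by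
  ext m
  simp only [spaceSeries, map_sum, coeff_ofCoeff]

theorem planeSeriesAB_of_length_ne_zero (a b : T) (f : List T → ZMod 2)
    (hf : ∀ w, w.length ≠ 0 → f w = 0) :
    planeSeriesAB a b f = inVariable 0 (lineSeries a f) := by
  rw [inVariable_zero_eq, planeSeriesAB]
  congr 1
  ext i j k
  rcases j with _ | j
  · simp [lineSeries]
  · rw [hf _ (by simp)]
    simp

theorem planeSeriesBC_of_length_ne_zero (b c : T) (f : List T → ZMod 2)
    (hf : ∀ w, w.length ≠ 0 → f w = 0) :
    planeSeriesBC b c f = inVariable 1 (lineSeries b f) := by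
  rw [inVariable_one_eq, planeSeriesBC]
  congr 1
  ext i j k
  rcases k with _ | k
  · simp [lineSeries]
  · rw [hf _ (by simp)]
    simp

theorem spaceSeries_of_length_ne_zero (a b c : T) (f : List T → ZMod 2)
    (hf : ∀ w, w.length ≠ 0 → f w = 0) :
    spaceSeries a b c f = inVariable 0 (lineSeries a f) := by
  rw [inVariable_zero_eq, spaceSeries]
  congr 1
  ext i j k
  rcases j with _ | j
  · rcases k with _ | k
    · simp [lineSeries, abcWord]
    · rw [hf _ (by simp [abcWord])]
      simp
  · rw [hf _ (by simp [abcWord])]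
    simp

theorem planeSeriesAB_of_length_ne_one (a b : T) (f : List T → ZMod 2)
    (hf : ∀ w, w.length ≠ 1 → f w = 0) :
    planeSeriesAB a b f = inVariable 0 (lineSeries a f) + inVariable 1 (lineSeries b f) := by
  rw [inVariable_zero_eq, inVariable_one_eq, planeSeriesAB, ofCoeff_add]
  congr 1
  ext i j k
  have h0 : f [] = 0 := hf _ (by simp)
  rcases i with _ | i <;> rcases j with _ | j
  · simp [lineSeries, h0]
  · simp [lineSeries]
  · simp [lineSeries]
  · rw [hf _ (by simp; omega)]
    simp

theorem planeSeriesBC_of_length_ne_one (b c : T) (f : List T → ZMod 2)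
    (hf : ∀ w, w.length ≠ 1 → f w = 0) :
    planeSeriesBC b c f = inVariable 1 (lineSeries b f) + inVariable 2 (lineSeries c f) := by
  rw [inVariable_one_eq, inVariable_two_eq, planeSeriesBC, ofCoeff_add]
  congr 1
  ext i j k
  have h0 : f [] = 0 := hf _ (by simp)
  rcases j with _ | j <;> rcases k with _ | k
  · simp [lineSeries, h0]
  · simp [lineSeries]
  · simp [lineSeries]
  · rw [hf _ (by simp; omega)]
    simp

theorem spaceSeries_of_length_ne_one (a b c : T) (f : List T → ZMod 2)
    (hf : ∀ w, w.length ≠ 1 → f w = 0) :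
    spaceSeries a b c f = inVariable 0 (lineSeries a f) + inVariable 1 (lineSeries b f) +
      inVariable 2 (lineSeries c f) := by
  rw [inVariable_zero_eq, inVariable_one_eq, inVariable_two_eq, spaceSeries, ofCoeff_add,
    ofCoeff_add]
  congr 1
  ext i j k
  -- The three axes share the constant term, so it must vanish for the sum over the axes to be
  -- correct.
  have h0 : f [] = 0 := hf _ (by simp)
  rcases i with _ | i <;> rcases j with _ | j <;> rcases k with _ | k
  · simp [lineSeries, abcWord, h0]
  · simp [lineSeries, abcWord]
  · simp [lineSeries, abcWord]
  · rw [hf _ (by simp [abcWord]; omega)]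
    simp
  · simp [lineSeries, abcWord]
  · rw [hf _ (by simp [abcWord]; omega)]
    simp
  · rw [hf _ (by simp [abcWord]; omega)]
    simp
  · rw [hf _ (by simp [abcWord]; omega)]
    simp

/-! ### Solving the systems for plane and space series -/

namespace GF2Grammar

variable (G : GF2Grammar T)

theorem count_nil_of_length_ne_zero (w : List T) (hw : w.length ≠ 0) : G.count [] w = 0 := by
  rw [count_nil_eq_ite_length, if_neg hw]

theorem count_terminal_of_length_ne_one (t : T) (w : List T) (hw : w.length ≠ 1) :
    G.count [.terminal t] w = 0 := by
  classical
  rw [count_terminal, if_neg]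
  rintro rfl
  exact hw rfl

theorem count_symbol (A : G.Productive) :
    G.count [G.symbol A] = fun w => ∑ r ∈ G.rulesOf A.1, G.count r.output w :=
  funext (G.count_nonterminal A.1)

/-- The coefficients generate only `F`, so by the adjugate formula the inverse matrix has entries in
`F`, which act on `V`. The inhomogeneous terms may lie in the larger ring `V`, where division is not
available. -/
theorem mem_of_linear_system_subfield {L : Type*} [Field L] (F : Subfield L) (V : Subring L)
    (hF : ∀ x ∈ F, x ∈ V) (P Q : List (Symbol T G.NT) → L)
    (hP : ∀ β, P β ∈ F) (hQ : ∀ β, Q β ∈ F)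
    (hdet : ∀ _ : DecidableEq G.Productive, (1 - G.systemMatrix P Q).det ≠ 0)
    (D : List (Symbol T G.NT) → L) (hnil : D [] ∈ V)
    (hcons : ∀ X β, D (X :: β) - (P [X] * D β + Q β * D [X]) ∈ V)
    (hterminal : ∀ t, D [.terminal t] ∈ V)
    (hzero : ∀ A, ¬(∃ w, Nonempty (ParseTree G.toContextFreeGrammar A w)) →
      D [.nonterminal A] = 0)
    (hrule : ∀ A : G.Productive, D [G.symbol A] = ∑ r ∈ G.rulesOf A.1, D r.output)
    (β : List (Symbol T G.NT)) : D β ∈ V := by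
  classical
  have hFV : ∀ x ∈ F, ∀ v ∈ V, x * v ∈ V := fun x hx v hv => mul_mem (hF x hx) hv
  have hconst : ∀ X, X ∉ Set.range G.symbol → D [X] ∈ V := by
    intro X hX
    obtain ⟨t, rfl⟩ | ⟨A, rfl, hA⟩ := G.terminal_or_not_productive hX
    · exact hterminal t
    · rw [hzero A hA]
      exact zero_mem V
  have hsymbol := G.mem_of_linear_system V.toAddSubgroup P Q (hdet _) D
    (fun A B v hv => hFV _ (F.inv_apply_mem _ (fun A B => sub_mem
      (by rw [Matrix.one_apply]; split_ifs; exacts [one_mem F, zero_mem F])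
      (sum_mem fun r _ => jacobian_mem F hP hQ _ _)) A B) v hv)
    (fun X => hFV _ (hP _)) hnil hcons (fun X hX β => hFV _ (hQ β) _ (hconst X hX)) hrule
  have hsingle : ∀ X, D [X] ∈ V := by
    intro X
    by_cases hX : X ∈ Set.range G.symbol
    · obtain ⟨A, rfl⟩ := hX
      exact hsymbol A
    · exact hconst X hX
  induction β with
  | nil => exact hnil
  | cons X β ih =>
    have := add_mem (hcons X β) (add_mem (hFV _ (hP [X]) _ ih) (hFV _ (hQ β) _ (hsingle X)))
    rwa [sub_add_cancel] at this

/-- The series of the words in `a^*`, `b^*` or `c^*` that are described by `β`. -/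
def axisCount (i : Fin 3) (a : T) (β : List (Symbol T G.NT)) : SeriesABC :=
  inVariableHom i (G.lineCount a β)

theorem inVariable_lineSeries_count (i : Fin 3) (a : T) (β : List (Symbol T G.NT)) :
    inVariable i (lineSeries a (G.count β)) = G.axisCount i a β := rfl

theorem axisCount_mem (i : Fin 3) (a : T) (β : List (Symbol T G.NT)) :
    G.axisCount i a β ∈ algebraicSubring i :=
  ⟨_, G.isAlgebraic_lineCount a β, rfl⟩

theorem constantCoeff_axisCount (i : Fin 3) (a : T) (β : List (Symbol T G.NT)) :
    MvPowerSeries.constantCoeff (G.axisCount i a β) = G.count β [] := by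
  rw [axisCount, constantCoeff_inVariableHom, constantCoeff_lineCount]

section field

variable {L : Type*} [Field L] (φ : SeriesABC →+* L)

theorem det_one_sub_systemMatrix_axisCount (hφ : Function.Injective φ) (i j : Fin 3) (a b : T)
    [DecidableEq G.Productive] :
    (1 - G.systemMatrix (fun β => φ (G.axisCount i a β))
      (fun β => φ (G.axisCount j b β))).det ≠ 0 :=
  G.det_one_sub_systemMatrix_ne_zero φ hφ MvPowerSeries.constantCoeff _ _
    (G.constantCoeff_axisCount i a) (G.constantCoeff_axisCount j b)

theorem planeSeriesAB_count_mem (hφ : Function.Injective φ) (a b : T)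
    (β : List (Symbol T G.NT)) :
    φ (planeSeriesAB a b (G.count β)) ∈ algebraicSubfield φ 0 1 := by
  have hP : ∀ β, φ (G.axisCount 0 a β) ∈ algebraicSubfield φ 0 1 := fun β =>
    map_mem_algebraicSubfield_left φ (G.axisCount_mem 0 a β)
  have hQ : ∀ β, φ (G.axisCount 1 b β) ∈ algebraicSubfield φ 0 1 := fun β =>
    map_mem_algebraicSubfield_right φ (G.axisCount_mem 1 b β)
  refine G.mem_of_linear_system_subfield (algebraicSubfield φ 0 1)
    (algebraicSubfield φ 0 1).toSubring (fun _ hx => hx) _ _ hP hQ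
    (fun _ => G.det_one_sub_systemMatrix_axisCount φ hφ 0 1 a b)
    (fun β => φ (planeSeriesAB a b (G.count β))) ?_ ?_ ?_ ?_ ?_ β
  · rw [planeSeriesAB_of_length_ne_zero a b _ G.count_nil_of_length_ne_zero]
    exact hP []
  · intro X β
    have h := congrArg φ (planeSeriesAB_conv a b (G.count [X]) (G.count β))
    rw [← count_cons] at h
    simp only [map_add, map_mul, inVariable_lineSeries_count] at h
    have : φ (planeSeriesAB a b (G.count (X :: β))) -
        (φ (G.axisCount 0 a [X]) * φ (planeSeriesAB a b (G.count β)) +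
          φ (G.axisCount 1 b β) * φ (planeSeriesAB a b (G.count [X]))) =
        -(φ (G.axisCount 0 a [X]) * φ (G.axisCount 1 b β)) := by
      linear_combination h
    simp only [this]
    exact neg_mem (mul_mem (hP _) (hQ _))
  · intro t
    rw [planeSeriesAB_of_length_ne_one a b _ (G.count_terminal_of_length_ne_one t), map_add]
    exact add_mem (hP [.terminal t]) (hQ [.terminal t])
  · intro A hA
    rw [G.count_eq_zero_of_not_productive A hA, ← map_zero φ]
    congr 1
    -- Additivity for the empty sum says that the series of the zero function is zero.
    simpa using! planeSeriesAB_sum a b ∅ (fun _ : Unit => (0 : List T → ZMod 2))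
  · intro A
    rw [count_symbol, planeSeriesAB_sum, map_sum]

theorem planeSeriesBC_count_mem (hφ : Function.Injective φ) (b c : T)
    (β : List (Symbol T G.NT)) :
    φ (planeSeriesBC b c (G.count β)) ∈ algebraicSubfield φ 1 2 := by
  have hP : ∀ β, φ (G.axisCount 1 b β) ∈ algebraicSubfield φ 1 2 := fun β =>
    map_mem_algebraicSubfield_left φ (G.axisCount_mem 1 b β)
  have hQ : ∀ β, φ (G.axisCount 2 c β) ∈ algebraicSubfield φ 1 2 := fun β =>
    map_mem_algebraicSubfield_right φ (G.axisCount_mem 2 c β)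
  refine G.mem_of_linear_system_subfield (algebraicSubfield φ 1 2)
    (algebraicSubfield φ 1 2).toSubring (fun _ hx => hx) _ _ hP hQ
    (fun _ => G.det_one_sub_systemMatrix_axisCount φ hφ 1 2 b c)
    (fun β => φ (planeSeriesBC b c (G.count β))) ?_ ?_ ?_ ?_ ?_ β
  · rw [planeSeriesBC_of_length_ne_zero b c _ G.count_nil_of_length_ne_zero]
    exact hP []
  · intro X β
    have h := congrArg φ (planeSeriesBC_conv b c (G.count [X]) (G.count β))
    rw [← count_cons] at h
    simp only [map_add, map_mul, inVariable_lineSeries_count] at h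
    have : φ (planeSeriesBC b c (G.count (X :: β))) -
        (φ (G.axisCount 1 b [X]) * φ (planeSeriesBC b c (G.count β)) +
          φ (G.axisCount 2 c β) * φ (planeSeriesBC b c (G.count [X]))) =
        -(φ (G.axisCount 1 b [X]) * φ (G.axisCount 2 c β)) := by
      linear_combination h
    simp only [this]
    exact neg_mem (mul_mem (hP _) (hQ _))
  · intro t
    rw [planeSeriesBC_of_length_ne_one b c _ (G.count_terminal_of_length_ne_one t), map_add]
    exact add_mem (hP [.terminal t]) (hQ [.terminal t])
  · intro A hA
    rw [G.count_eq_zero_of_not_productive A hA, ← map_zero φ]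
    congr 1
    simpa using! planeSeriesBC_sum b c ∅ (fun _ : Unit => (0 : List T → ZMod 2))
  · intro A
    rw [count_symbol, planeSeriesBC_sum, map_sum]

/-- The system is solved over the field for `a` and `c`. Its inhomogeneous part consists of products
of plane and line series, already known to be admissible fractions. -/
theorem spaceSeries_count_mem (hφ : Function.Injective φ) (a b c : T)
    (β : List (Symbol T G.NT)) :
    φ (spaceSeries a b c (G.count β)) ∈ fractionSubring φ hφ := by
  have hP : ∀ β, φ (G.axisCount 0 a β) ∈ algebraicSubfield φ 0 2 := fun β =>
    map_mem_algebraicSubfield_left φ (G.axisCount_mem 0 a β)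
  have hQ : ∀ β, φ (G.axisCount 2 c β) ∈ algebraicSubfield φ 0 2 := fun β =>
    map_mem_algebraicSubfield_right φ (G.axisCount_mem 2 c β)
  have hle {x : L} (hx : x ∈ algebraicSubfield φ 0 2) : x ∈ fractionSubring φ hφ :=
    algebraicSubfield_le φ hφ (by decide) hx
  have hAB : ∀ β, φ (planeSeriesAB a b (G.count β)) ∈ fractionSubring φ hφ := fun β =>
    algebraicSubfield_le φ hφ (by decide) (G.planeSeriesAB_count_mem φ hφ a b β)
  have hBC : ∀ β, φ (planeSeriesBC b c (G.count β)) ∈ fractionSubring φ hφ := fun β =>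
    algebraicSubfield_le φ hφ (by decide) (G.planeSeriesBC_count_mem φ hφ b c β)
  refine G.mem_of_linear_system_subfield (algebraicSubfield φ 0 2)
    (fractionSubring φ hφ) (fun _ => hle) _ _ hP hQ
    (fun _ => G.det_one_sub_systemMatrix_axisCount φ hφ 0 2 a c)
    (fun β => φ (spaceSeries a b c (G.count β))) ?_ ?_ ?_ ?_ ?_ β
  · rw [spaceSeries_of_length_ne_zero a b c _ G.count_nil_of_length_ne_zero]
    exact hle (hP [])
  · intro X β
    have h := congrArg φ (spaceSeries_conv a b c (G.count [X]) (G.count β))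
    rw [← count_cons] at h
    simp only [map_add, map_mul, inVariable_lineSeries_count] at h
    have : φ (spaceSeries a b c (G.count (X :: β))) -
        (φ (G.axisCount 0 a [X]) * φ (spaceSeries a b c (G.count β)) +
          φ (G.axisCount 2 c β) * φ (spaceSeries a b c (G.count [X]))) =
        φ (planeSeriesAB a b (G.count [X])) * φ (planeSeriesBC b c (G.count β)) -
          φ (G.axisCount 0 a [X]) * φ (planeSeriesBC b c (G.count β)) -
          φ (planeSeriesAB a b (G.count [X])) * φ (G.axisCount 2 c β) := by
      linear_combination h
    simp only [this]
    exact sub_mem (sub_mem (mul_mem (hAB _) (hBC _)) (mul_mem (hle (hP _)) (hBC _)))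
      (mul_mem (hAB _) (hle (hQ _)))
  · intro t
    rw [spaceSeries_of_length_ne_one a b c _ (G.count_terminal_of_length_ne_one t), map_add,
      map_add]
    -- The line series in `b` is not supplied by the field for `a` and `c`; it is admissible through
    -- the field for `a` and `b`.
    exact add_mem (add_mem (hle (hP [.terminal t])) (algebraicSubfield_le φ hφ (by decide)
      (map_mem_algebraicSubfield_right (i := 0) φ (G.axisCount_mem 1 b [.terminal t]))))
      (hle (hQ [.terminal t]))
  · intro A hA
    rw [G.count_eq_zero_of_not_productive A hA, ← map_zero φ]
    congr 1
  · intro A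
    rw [count_symbol, spaceSeries_sum, map_sum]

end field

theorem dualSeries_language (a b c : T) :
    dualSeries a b c G.language = spaceSeries a b c (G.count [.nonterminal G.initial]) := by
  funext m
  by_cases h : abcWord a b c (m 0) (m 1) (m 2) ∈ G.language
  · exact (if_pos h).trans (ZMod.natCast_eq_one_iff_odd.mpr h).symm
  · exact (if_neg h).trans (ZMod.natCast_eq_zero_iff_even.mpr (Nat.not_odd_iff_even.mp h)).symm

end GF2Grammar
end

theorem theorem4p1 {T : Type*} (a b c : T) (hab : a ≠ b) (hac : a ≠ c) (hbc : b ≠ c)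
    (K : Language T) (hK : K ≤ abcLanguage a b c)
    (hG : ∃ G : GF2Grammar T, G.language = K) :
    algebraMap SeriesABC LaurentABC (dualSeries a b c K) ∈ RABC := by
  obtain ⟨G, rfl⟩ := hG
  have h : Function.Injective (algebraMap SeriesABC LaurentABC) := IsFractionRing.injective _ _
  rw [G.dualSeries_language]
  exact mem_RABC_of_mem_fractionSubring h (G.spaceSeries_count_mem _ h a b c _)
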